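/- Let $K$ be an algebraically closed field and let $E$ be an elliptic curve over $K$ with complex multiplication by $R$, where $R$ is an order in an imaginary quadratic field $F$: that is, an embedding of rings $R\hookrightarrow \mathrm{End}(E)$, $\omega\mapsto[\omega]$, is given. Let $\pi:E\to\mathbb P^1$ be the quotient of $E$ by the hyperelliptic involution $P\mapsto -P$, given by the $x$-coordinate of a Weierstrass equation, and for $\omega\in R$ let $\varphi_{[\omega]}:\mathbb P^1\to\mathbb P^1$ be the Lattès map, the unique map with $\varphi_{[\omega]}\circ\pi=\pi\circ[\omega]$. Let $\Delta'=\{(P,P): P\in\mathbb P^1\}\subset\mathbb P^1\times\mathbb P^1$ be the diagonal. Let $\omega,\omega'\in R$ be nonzero. Then $\Delta'$ is pre-periodic for $\varphi_{[\omega]}\times\varphi_{[\omega']}:\mathbb P^1\times\mathbb P^1\to\mathbb P^1\times\mathbb P^1$, i.e. there are integers $n\ge 0$ and $k>0$ with $$(\varphi_{[\omega]}\times\varphi_{[\omega']})^{n+k}(\Delta')=(\varphi_{[\omega]}\times\varphi_{[\omega']})^{n}(\Delta'),$$ if and only if there is an integer $k>0$ with $(\omega/\omega')^k=1$ or $(\omega/\omega')^k=-1$.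 -/

import Mathlib

open scoped LinearAlgebra.Projectivization

namespace CMLattes

/-- The subset `Y ⊆ X` is pre-periodic for the self-map `φ : X → X`: there are natural numbers
`n` and `k > 0` such that the images satisfy `φ^(n+k)(Y) = φ^n(Y)`. -/
def IsPreperiodic {X : Type*} (φ : X → X) (Y : Set X) : Prop :=
  ∃ n k : ℕ, 0 < k ∧ φ^[n + k] '' Y = φ^[n] '' Y

/-- A subring `R` of a number field `F` is an order of `F` if it is finitely generated as an
abelian group and spans `F` over `ℚ`. -/
structure IsOrder {F : Type*} [Field F] [NumberField F] (R : Subring F) : Prop where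
  finite : Module.Finite ℤ R
  span_eq_top : Submodule.span ℚ (R : Set F) = ⊤

section Curve

variable {K : Type*} [Field K] {W : WeierstrassCurve.Affine K}

/-- Homogeneous coordinates in `ℙ²` of a point of a Weierstrass curve: the affine point `(x, y)`
is `[x : y : 1]`, and the point at infinity is `[0 : 1 : 0]`. -/
def homCoord : W.Point → Fin 3 → K
  | .zero => ![0, 1, 0]
  | .some x y _ => ![x, y, 1]

/-- A self-map `f` of the set of points of a Weierstrass curve in `ℙ²` over an algebraically
closed field is a morphism of varieties: around every point `P` it is given by a triple of
homogeneous polynomials of the same degree without a common zero at `P`. -/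
def IsMorphism (f : W.Point → W.Point) : Prop :=
  ∀ P : W.Point, ∃ (d : ℕ) (p : Fin 3 → MvPolynomial (Fin 3) K),
    (∀ i, (p i).IsHomogeneous d) ∧
    (∃ i, MvPolynomial.eval (homCoord P) (p i) ≠ 0) ∧
    ∀ Q : W.Point, (∃ i, MvPolynomial.eval (homCoord Q) (p i) ≠ 0) →
      ∃ c : K, c ≠ 0 ∧ ∀ i, MvPolynomial.eval (homCoord Q) (p i) = c * homCoord (f Q) i

/-- The quotient map `π : E → ℙ¹` by the hyperelliptic involution `P ↦ -P`: it is the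
`x`-coordinate `(x, y) ↦ [x : 1]`, and it sends the point at infinity to `[1 : 0]`. -/
noncomputable def proj (P : W.Point) : ℙ K (Fin 2 → K) :=
  Projectivization.mk K P.xRep P.xRep_ne_zero

lemma proj_eq_iff {P Q : W.Point} : proj P = proj Q ↔ P = Q ∨ P = -Q := by
  rw [← WeierstrassCurve.Affine.Point.xRep_eq_xRep_iff]
  refine ⟨fun h => ?_, fun h => by simp only [proj, h]⟩
  rw [proj, proj, Projectivization.mk_eq_mk_iff'] at h
  obtain ⟨a, ha⟩ := h
  rcases P with _ | ⟨x, y, hP⟩ <;> rcases Q with _ | ⟨x', y', hQ⟩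
  · rfl
  · have h1 := congrFun ha 1
    have h0 := congrFun ha 0
    simp [WeierstrassCurve.Affine.Point.xRep] at h0 h1
    simp [h1] at h0
  · have h1 := congrFun ha 1
    simp [WeierstrassCurve.Affine.Point.xRep] at h1
  · have h1 := congrFun ha 1
    simp [WeierstrassCurve.Affine.Point.xRep] at h1
    simpa [h1] using ha.symm

lemma proj_surjective [IsAlgClosed K] [W.IsElliptic] :
    Function.Surjective (proj : W.Point → ℙ K (Fin 2 → K)) := by
  intro t
  induction t using Projectivization.ind with
  | h v hv =>
  by_cases h1 : v 1 = 0
  · have h0 : v 0 ≠ 0 := fun h0 => hv (by ext i; fin_cases i <;> simp [h0, h1])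
    refine ⟨0, (Projectivization.mk_eq_mk_iff' K _ _ _ _).2 ⟨(v 0)⁻¹, ?_⟩⟩
    ext i
    fin_cases i <;> simp [h0, h1]
  · set x : K := v 0 / v 1 with hx
    obtain ⟨y, hy⟩ := IsAlgClosed.exists_root
      (Polynomial.X ^ 2 + Polynomial.C (W.a₁ * x + W.a₃) * Polynomial.X
        + Polynomial.C (-(x ^ 3 + W.a₂ * x ^ 2 + W.a₄ * x + W.a₆)))
      (by
        have h : (Polynomial.X ^ 2 + Polynomial.C (W.a₁ * x + W.a₃) * Polynomial.X
          + Polynomial.C (-(x ^ 3 + W.a₂ * x ^ 2 + W.a₄ * x + W.a₆))).degree = 2 := by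
          compute_degree!
        rw [h]
        decide)
    have hE : W.Equation x y := by
      rw [WeierstrassCurve.Affine.equation_iff]
      simp only [Polynomial.IsRoot, Polynomial.eval_add, Polynomial.eval_mul, Polynomial.eval_pow,
        Polynomial.eval_X, Polynomial.eval_C] at hy
      linear_combination hy
    refine ⟨.some x y (WeierstrassCurve.Affine.equation_iff_nonsingular.1 hE),
      (Projectivization.mk_eq_mk_iff' K _ _ _ _).2 ⟨(v 1)⁻¹, ?_⟩⟩
    ext i
    fin_cases i
    · simp [hx, div_eq_inv_mul]
    · simp [h1]

/-- The self-map `φ_f` of `ℙ¹` induced by an endomorphism `f` of the group of points of an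
elliptic curve. As `π` is surjective and `f (-P) = -f P`, it is the unique map with
`φ_f ∘ π = π ∘ f`, see `lattes_proj`. -/
noncomputable def lattes [DecidableEq K] [IsAlgClosed K] [W.IsElliptic]
    (f : AddMonoid.End W.Point) : ℙ K (Fin 2 → K) → ℙ K (Fin 2 → K) :=
  fun t => proj (f (Function.surjInv (proj_surjective (W := W)) t))

lemma lattes_proj [DecidableEq K] [IsAlgClosed K] [W.IsElliptic]
    (f : AddMonoid.End W.Point) (P : W.Point) : lattes f (proj P) = proj (f P) := by
  have h : proj (Function.surjInv (proj_surjective (W := W)) (proj P)) = proj P :=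
    Function.surjInv_eq proj_surjective (proj P)
  rcases proj_eq_iff.1 h with h | h
  · rw [lattes, h]
  · rw [lattes, h, map_neg]
    exact proj_eq_iff.2 (Or.inr rfl)

end Curve

/-- Complex multiplication by the ring `R` on the elliptic curve `W` over an algebraically closed
field: an embedding `ω ↦ [ω]` of `R` into the ring of endomorphisms of `W`, that is, of those
endomorphisms of the group of points that are morphisms of varieties. -/
structure ComplexMultiplication {K : Type*} [Field K] [DecidableEq K]
    (W : WeierstrassCurve.Affine K) (R : Type*) [CommRing R] where
  /-- The endomorphism `[ω]` of the curve attached to `ω`. -/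
  mulBy : R →+* AddMonoid.End W.Point
  injective : Function.Injective mulBy
  isMorphism : ∀ ω : R, IsMorphism (mulBy ω)

end CMLattes

/-!
The image of the diagonal under the `m`-th iterate is `{(π([ω]^m P), π([ω']^m P)) : P ∈ E}`,
because `φ_{[ω]} ∘ π = π ∘ [ω]`.

If the images for `m = n + k` and `m = n` agree, then for every `P` there is a `Q` with
`[ω]^(n+k) P = ±[ω]^n Q` and `[ω']^(n+k) P = ±[ω']^n Q`. Eliminating `Q` by commutativity, every `P`
is killed by `[(ωω')^n (ω^k - ω'^k)]` or by `[(ωω')^n (ω^k + ω'^k)]`. A group is not the union of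
two proper subgroups, so one of these endomorphisms is zero, and `ω^k = ±ω'^k` since `R` embeds in
the endomorphism ring (`exists_pow_eq_of_isPreperiodic`).

Conversely, if `ω^k = ±ω'^k`, then `[ω]^k P = ±[ω']^k P` for all `P`, so the diagonal is mapped into
itself by the `k`-th iterate, and onto itself because `[ω'^k]` is surjective
(`isPreperiodic_of_pow_eq`).

The geometric input is thus that a nonzero endomorphism `f` of `E` is surjective
(`IsMorphism.surjective`). If the point `(x₀, y₀)` is not in the image of `f`, then neither is its
negative, so `1 / (x ∘ f - x₀)` is a regular function on all of `E`, and it vanishes at infinity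
since `f 0 = 0`. A regular function which vanishes at infinity is zero (`IsRegular.eq_zero`): by the
Nullstellensatz it is given by a polynomial on the affine curve, and its pole order at infinity
is negative. Then `f` maps every point to infinity, so `f = 0`.
-/

namespace CMLattes

open WeierstrassCurve.Affine Polynomial

variable {K : Type*} [Field K] {W : WeierstrassCurve.Affine K}

/-! ### Pole orders at infinity on the affine coordinate ring -/

/-- The degree of the norm to `K[X]` is the pole order at infinity, whence the ultrametric
inequality. Here it follows from the formula for the degree of the norm of `p + q Y`, as the two
degrees `2 deg p` and `2 deg q + 3` have different parities and cannot cancel. -/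
lemma degree_norm_add_le (g h : W.CoordinateRing) :
    (Algebra.norm K[X] (g + h)).degree ≤
      max (Algebra.norm K[X] g).degree (Algebra.norm K[X] h).degree := by
  obtain ⟨p, q, rfl⟩ := CoordinateRing.exists_smul_basis_eq g
  obtain ⟨r, s, rfl⟩ := CoordinateRing.exists_smul_basis_eq h
  have : p • (1 : W.CoordinateRing) + q • CoordinateRing.mk W X
      + (r • 1 + s • CoordinateRing.mk W X)
      = (p + r) • 1 + (q + s) • CoordinateRing.mk W X := by
    rw [add_smul, add_smul]; abel
  rw [this]
  simp only [CoordinateRing.degree_norm_smul_basis]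
  have h1 := degree_add_le p r
  have h2 := degree_add_le q s
  rcases le_max_iff.1 h1 with h1 | h1 <;> rcases le_max_iff.1 h2 with h2 | h2 <;>
    refine max_le ?_ ?_
  all_goals first
    | exact (nsmul_le_nsmul_right h1 2).trans (by simp)
    | exact (add_le_add_left (nsmul_le_nsmul_right h2 2) 3).trans (by simp)

lemma norm_ne_zero {g : W.CoordinateRing} (hg : g ≠ 0) : Algebra.norm K[X] g ≠ 0 :=
  fun h => hg ((Algebra.norm_eq_zero_iff_of_basis (CoordinateRing.basis W)).1 h)

variable (W) in
/-- Dehomogenization: restriction of a polynomial in `X, Y, Z` to the affine curve in the chart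
`Z = 1`. -/
noncomputable def dehomogenize : MvPolynomial (Fin 3) K →ₐ[K] W.CoordinateRing :=
  MvPolynomial.aeval ![CoordinateRing.mk W (C X), CoordinateRing.mk W X, 1]

lemma degree_norm_X : (Algebra.norm K[X] (CoordinateRing.mk W (C X))).degree = (2 : ℕ) := by
  have h := CoordinateRing.degree_norm_smul_basis (W' := W) (X : K[X]) 0
  rw [CoordinateRing.smul, zero_smul, add_zero, mul_one] at h
  rw [h]
  simp

lemma degree_norm_Y : (Algebra.norm K[X] (CoordinateRing.mk W X)).degree = (3 : ℕ) := by
  have h := CoordinateRing.degree_norm_smul_basis (W' := W) (0 : K[X]) 1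
  rw [zero_smul, one_smul, zero_add] at h
  rw [h]
  simp

lemma degree_norm_C {c : K} (hc : c ≠ 0) :
    (Algebra.norm K[X] (algebraMap K W.CoordinateRing c)).degree = 0 := by
  have h := CoordinateRing.degree_norm_smul_basis (W' := W) (C c : K[X]) 0
  rw [zero_smul, add_zero, Algebra.smul_def, mul_one] at h
  rw [IsScalarTower.algebraMap_apply K K[X] W.CoordinateRing]
  refine h.trans ?_
  simp [degree_C hc]

lemma degree_norm_dehomogenize_monomial (s : Fin 3 →₀ ℕ) {c : K} (hc : c ≠ 0) :
    (Algebra.norm K[X] (dehomogenize W (MvPolynomial.monomial s c))).degree =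
      (2 * s 0 + 3 * s 1 : ℕ) := by
  rw [dehomogenize, MvPolynomial.aeval_monomial, Finsupp.prod_fintype _ _ (by simp),
    Fin.prod_univ_three]
  simp only [Matrix.cons_val, one_pow, mul_one, map_mul, map_pow, degree_mul, degree_pow,
    degree_norm_C hc, degree_norm_X, degree_norm_Y, zero_add]
  simp [mul_comm]

/-- A homogeneous polynomial of degree `d` which vanishes at `[0 : 1 : 0]` has no monomial `Y ^ d`,
and all other monomials of degree `d` have pole order less than `3 * d`. -/
lemma degree_norm_dehomogenize_lt {p : MvPolynomial (Fin 3) K} {d : ℕ} (hp : p.IsHomogeneous d)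
    (h0 : MvPolynomial.eval ![0, 1, 0] p = 0) :
    (Algebra.norm K[X] (dehomogenize W p)).degree < (3 * d : ℕ) := by
  have hdeg : ∀ s ∈ p.support, s 0 + s 1 + s 2 = d := fun s hs => by
    have := hp (MvPolynomial.mem_support_iff.1 hs)
    rw [Finsupp.weight_apply, Finsupp.sum_fintype _ _ (by simp), Fin.sum_univ_three] at this
    simpa using this
  have hs1 : ∀ s ∈ p.support, s 1 ≠ d := by
    intro s hs h1
    have hd := hdeg s hs
    rw [MvPolynomial.eval_eq', Finset.sum_eq_single s] at h0
    · refine MvPolynomial.mem_support_iff.1 hs ?_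
      have h0' : s 0 = 0 := by omega
      have h2' : s 2 = 0 := by omega
      simpa [Fin.prod_univ_three, h0', h2'] using h0
    · intro t ht hts
      have ht' := hdeg t ht
      have : t 0 ≠ 0 ∨ t 2 ≠ 0 := by
        by_contra! h
        refine hts (Finsupp.ext fun i => ?_)
        fin_cases i <;> simp <;> omega
      rcases this with h | h <;> simp [Fin.prod_univ_three, h]
    · exact fun h => absurd hs h
  rw [p.as_sum, map_sum]
  refine Finset.sum_induction _
    (fun g : W.CoordinateRing => (Algebra.norm K[X] g).degree < (3 * d : ℕ))
    (fun a b ha hb => (degree_norm_add_le a b).trans_lt (max_lt ha hb)) ?_ ?_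
  · rw [(Algebra.norm_eq_zero_iff_of_basis (CoordinateRing.basis W)).2 rfl, degree_zero]
    exact WithBot.bot_lt_coe _
  · intro s hs
    rw [degree_norm_dehomogenize_monomial s (MvPolynomial.mem_support_iff.1 hs)]
    have h1 := hdeg s hs
    have h2 := hs1 s hs
    exact_mod_cast (by omega : 2 * s 0 + 3 * s 1 < 3 * d)

/-- A homogeneous polynomial of degree `d` which does not vanish at `[0 : 1 : 0]` contains the
monomial `Y ^ d`, of pole order `3 * d`, which dominates all the others. -/
lemma le_degree_norm_dehomogenize {p : MvPolynomial (Fin 3) K} {d : ℕ} (hp : p.IsHomogeneous d)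
    (h0 : MvPolynomial.eval ![0, 1, 0] p ≠ 0) :
    (3 * d : ℕ) ≤ (Algebra.norm K[X] (dehomogenize W p)).degree := by
  set c := MvPolynomial.eval ![0, 1, 0] p
  set m : MvPolynomial (Fin 3) K := MvPolynomial.monomial (Finsupp.single 1 d) c
  have hm : m.IsHomogeneous d := MvPolynomial.isHomogeneous_monomial _ (by simp)
  have hlt := degree_norm_dehomogenize_lt (W := W) (hm.sub hp)
    (by simp [m, c, MvPolynomial.eval_monomial])
  have hle := degree_norm_add_le (dehomogenize W p) (dehomogenize W (m - p))
  rw [← map_add, add_sub_cancel, degree_norm_dehomogenize_monomial _ h0] at hle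
  simp only [Finsupp.single_apply, Fin.reduceEq, if_false, if_true, mul_zero, zero_add] at hle
  exact (le_max_iff.1 hle).resolve_right hlt.not_ge

/-! ### Evaluation at the points of the affine curve -/

lemma exists_evalHom {x y : K} (h : W.Equation x y) :
    ∃ ev : W.CoordinateRing →+* K,
      (∀ p q : K[X], ev (p • 1 + q • CoordinateRing.mk W X) = p.eval x + q.eval x * y) ∧
      ∀ p, ev (dehomogenize W p) = MvPolynomial.eval ![x, y, 1] p := by
  have h' : W.polynomial.eval₂ (evalRingHom x) y = 0 := by
    rw [eval₂_evalRingHom]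
    exact h
  refine ⟨AdjoinRoot.lift (evalRingHom x) y h', fun p q => ?_, fun p => ?_⟩
  · simp [CoordinateRing.smul]
  · have : ((AdjoinRoot.lift (evalRingHom x) y h').comp (dehomogenize W).toRingHom)
        = MvPolynomial.eval ![x, y, 1] := by
      refine MvPolynomial.ringHom_ext (fun c => ?_) (fun i => ?_)
      · simp only [AlgHom.toRingHom_eq_coe, RingHom.coe_comp, RingHom.coe_coe,
          Function.comp_apply, MvPolynomial.eval_C]
        rw [← MvPolynomial.algebraMap_eq, AlgHom.commutes,
          IsScalarTower.algebraMap_apply K K[X] W.CoordinateRing]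
        exact (AdjoinRoot.lift_of h').trans (by simp)
      · fin_cases i <;> simp [dehomogenize]
    exact RingHom.congr_fun this p

lemma exists_equation [IsAlgClosed K] [W.IsElliptic] (x : K) : ∃ y, W.Equation x y := by
  obtain ⟨P, hP⟩ := proj_surjective (W := W)
    (Projectivization.mk K ![x, 1] fun h => one_ne_zero (congrFun h 1))
  rw [proj, Projectivization.mk_eq_mk_iff'] at hP
  obtain ⟨a, ha⟩ := hP
  rcases P with _ | ⟨x', y', h⟩
  · have h0 := congrFun ha 0
    have h1 := congrFun ha 1
    simp [WeierstrassCurve.Affine.Point.xRep] at h0 h1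
    simp [h1] at h0
  · have h0 := congrFun ha 0
    have h1 := congrFun ha 1
    simp [WeierstrassCurve.Affine.Point.xRep] at h0 h1
    rw [h1, one_mul] at h0
    exact ⟨y', h0 ▸ h.1⟩

/-- A polynomial function which vanishes at all affine points is zero in the coordinate ring: its
norm vanishes at every `x`, since every `x` is the coordinate of a point. -/
lemma dehomogenize_eq_zero [IsAlgClosed K] [W.IsElliptic] {p : MvPolynomial (Fin 3) K}
    (hp : ∀ x y, W.Equation x y → MvPolynomial.eval ![x, y, 1] p = 0) :
    dehomogenize W p = 0 := by
  obtain ⟨r, s, hrs⟩ := CoordinateRing.exists_smul_basis_eq (dehomogenize W p)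
  by_contra hne
  refine norm_ne_zero hne (Polynomial.funext fun x => ?_)
  obtain ⟨y, hy⟩ := exists_equation (W := W) x
  obtain ⟨ev, hev, hev'⟩ := exists_evalHom hy
  have h := hp x y hy
  rw [← hev', ← hrs, hev] at h
  rw [← hrs, CoordinateRing.norm_smul_basis]
  rw [WeierstrassCurve.Affine.equation_iff] at hy
  simp only [eval_sub, eval_mul, eval_add, eval_pow, eval_X, eval_C, eval_zero]
  -- With `r + s y = 0`, the norm `r² - r s (a₁ x + a₃) - s² (x³ + ⋯)` is `s²` times the equation.
  linear_combination (r.eval x - s.eval x * y - s.eval x * (W.a₁ * x + W.a₃)) * h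
    + s.eval x ^ 2 * hy

/-! ### Regular functions on the projective curve -/

lemma homCoord_zero : homCoord (.zero : W.Point) = ![0, 1, 0] := rfl

lemma homCoord_some (x y : K) (h : W.Nonsingular x y) : homCoord (.some x y h) = ![x, y, 1] := rfl

/-- A `K`-valued function on a projective Weierstrass curve is regular if around every point it is
a quotient `A / B` of two homogeneous polynomials of the same degree. The equation `B * h = A` is
required at all points: it can be arranged outside the locus `B ≠ 0` by multiplying both `A` and
`B` by `B`. -/
def IsRegular (h : W.Point → K) : Prop :=
  ∀ P : W.Point, ∃ (d : ℕ) (A B : MvPolynomial (Fin 3) K),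
    A.IsHomogeneous d ∧ B.IsHomogeneous d ∧ MvPolynomial.eval (homCoord P) B ≠ 0 ∧
    ∀ Q : W.Point, MvPolynomial.eval (homCoord Q) B * h Q = MvPolynomial.eval (homCoord Q) A

/-- A regular function is polynomial on the affine curve: the denominators `B` such that `B * h` is
polynomial form an ideal, and by the Nullstellensatz it is proper only if all of them vanish at some
point of the curve. -/
lemma IsRegular.exists_eval_eq [IsAlgClosed K] [W.IsElliptic] {h : W.Point → K}
    (hh : IsRegular h) :
    ∃ H : MvPolynomial (Fin 3) K, ∀ x y hxy,
      h (.some x y hxy) = MvPolynomial.eval ![x, y, 1] H := by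
  obtain ⟨J, mem_J⟩ : ∃ J : Ideal (MvPolynomial (Fin 3) K), ∀ B, B ∈ J ↔
      ∃ A : MvPolynomial (Fin 3) K, ∀ x y hxy,
        MvPolynomial.eval ![x, y, 1] B * h (.some x y hxy) = MvPolynomial.eval ![x, y, 1] A :=
    ⟨{carrier := {B | ∃ A : MvPolynomial (Fin 3) K, ∀ x y hxy,
        MvPolynomial.eval ![x, y, 1] B * h (.some x y hxy) = MvPolynomial.eval ![x, y, 1] A}
      zero_mem' := ⟨0, fun x y hxy => by rw [map_zero, zero_mul]⟩
      add_mem' := by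
        rintro B B' ⟨A, hA⟩ ⟨A', hA'⟩
        exact ⟨A + A', fun x y hxy => by rw [map_add, map_add, add_mul, hA, hA']⟩
      smul_mem' := by
        rintro c B ⟨A, hA⟩
        exact ⟨c * A, fun x y hxy => by rw [smul_eq_mul, map_mul, map_mul, mul_assoc, hA]⟩},
      fun B => Iff.rfl⟩
  suffices hJ : (1 : MvPolynomial (Fin 3) K) ∈ J by
    obtain ⟨A, hA⟩ := (mem_J 1).1 hJ
    exact ⟨A, fun x y hxy => by simpa using hA x y hxy⟩
  by_contra h1
  obtain ⟨M, hM, hJM⟩ := Ideal.exists_le_maximal J ((Ideal.ne_top_iff_one J).2 h1)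
  obtain ⟨v, rfl⟩ := MvPolynomial.isMaximal_iff_eq_vanishingIdeal_singleton.1 hM
  have hv : ∀ B ∈ J, MvPolynomial.eval v B = 0 := fun B hB => by
    simpa [MvPolynomial.aeval_eq_eval] using hJM hB
  -- `v` lies in the chart `Z = 1`, and on the curve.
  have hv2 : v 2 = 1 := by
    have := hv (MvPolynomial.X 2 - 1) ((mem_J _).2 ⟨0, fun x y hxy => by simp⟩)
    simpa [sub_eq_zero] using this
  have hvE : W.Equation (v 0) (v 1) := by
    have := hv (MvPolynomial.X 1 ^ 2 + MvPolynomial.C W.a₁ * MvPolynomial.X 0 * MvPolynomial.X 1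
      + MvPolynomial.C W.a₃ * MvPolynomial.X 1 - (MvPolynomial.X 0 ^ 3
      + MvPolynomial.C W.a₂ * MvPolynomial.X 0 ^ 2 + MvPolynomial.C W.a₄ * MvPolynomial.X 0
      + MvPolynomial.C W.a₆)) ((mem_J _).2 ⟨0, fun x y hxy => by
        have := hxy.1
        rw [WeierstrassCurve.Affine.equation_iff] at this
        simp [this]⟩)
    rw [WeierstrassCurve.Affine.equation_iff]
    simpa [sub_eq_zero] using this
  obtain ⟨d, A, B, -, -, hB, hAB⟩ :=
    hh (.some _ _ (WeierstrassCurve.Affine.equation_iff_nonsingular.1 hvE))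
  have hvec : ![v 0, v 1, 1] = v := by
    ext i
    fin_cases i <;> simp [hv2]
  rw [homCoord_some, hvec] at hB
  exact hB (hv B ((mem_J B).2 ⟨A, fun x y hxy => hAB (.some x y hxy)⟩))

/-- A regular function on a projective Weierstrass curve which vanishes at infinity is zero. It is
given by an `H` in the coordinate ring with `B * H = A`, where `A` has a smaller pole order than `B`
as `A` vanishes at infinity and `B` does not; so `H` would have a negative pole order. -/
theorem IsRegular.eq_zero [IsAlgClosed K] [W.IsElliptic] {h : W.Point → K} (hh : IsRegular h)
    (h0 : h 0 = 0) (P : W.Point) : h P = 0 := by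
  obtain ⟨H, hH⟩ := hh.exists_eval_eq
  obtain ⟨d, A, B, hA, hB, hB0, hAB⟩ := hh 0
  have hA0 := hAB 0
  rw [h0, mul_zero] at hA0
  have hmul : dehomogenize W B * dehomogenize W H = dehomogenize W A := by
    rw [← map_mul, ← sub_eq_zero, ← map_sub]
    refine dehomogenize_eq_zero fun x y hxy => ?_
    have hxy' := WeierstrassCurve.Affine.equation_iff_nonsingular.1 hxy
    have := hAB (.some x y hxy')
    rw [hH] at this
    rw [map_sub, map_mul, sub_eq_zero]
    exact this
  have hz : dehomogenize W H = 0 := by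
    by_contra hne
    have h1 := le_degree_norm_dehomogenize (W := W) hB hB0
    have h2 := degree_norm_dehomogenize_lt (W := W) hA hA0.symm
    rw [← hmul, map_mul, degree_mul] at h2
    have h3 := zero_le_degree_iff.2 (norm_ne_zero hne)
    exact absurd h2 (not_lt.2 (h1.trans (le_add_of_nonneg_right h3)))
  rcases P with _ | ⟨x, y, hxy⟩
  · exact h0
  · obtain ⟨ev, -, hev⟩ := exists_evalHom hxy.1
    rw [hH, ← hev, hz, map_zero]

/-! ### Surjectivity of nonzero endomorphisms -/

/-- The rational function `1 / (x - x₀)`, extended by `0` to the point at infinity. It takes the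
junk value `0` at the points with `x = x₀`. -/
noncomputable def invXSub (x₀ : K) : W.Point → K
  | .zero => 0
  | .some x _ _ => (x - x₀)⁻¹

lemma invXSub_zero (x₀ : K) : invXSub x₀ (.zero : W.Point) = 0 := rfl

lemma invXSub_some (x₀ x y : K) (h : W.Nonsingular x y) :
    invXSub x₀ (.some x y h) = (x - x₀)⁻¹ := rfl

lemma IsMorphism.isRegular_invXSub_comp {f : W.Point → W.Point} (hf : IsMorphism f) {x₀ : K}
    (hx₀ : ∀ P x y hxy, f P = .some x y hxy → x ≠ x₀) :
    IsRegular fun P => invXSub x₀ (f P) := by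
  intro P
  obtain ⟨d, p, hp, ⟨i, hi⟩, hpf⟩ := hf P
  obtain ⟨c, hc, hcP⟩ := hpf P ⟨i, hi⟩
  rcases hfP : f P with _ | ⟨x, y, hxy⟩
  · -- Near infinity, `1 / x = x² / x³`, and the equation of the curve replaces `x³` by an
    -- expression that does not vanish at `[0 : 1 : 0]`.
    refine ⟨2 * d, p 0 ^ 2, p 1 ^ 2 + MvPolynomial.C W.a₁ * (p 0 * p 1)
      + MvPolynomial.C W.a₃ * (p 1 * p 2) - MvPolynomial.C W.a₂ * (p 0 ^ 2)
      - MvPolynomial.C W.a₄ * (p 0 * p 2) - MvPolynomial.C W.a₆ * (p 2 ^ 2)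
      - MvPolynomial.C x₀ * (p 0 ^ 2), ?_, ?_, ?_, fun Q => ?_⟩
    · simpa [mul_comm] using (hp 0).pow 2
    · have hsq : ∀ i, (p i ^ 2).IsHomogeneous (2 * d) := fun i => by
        simpa [mul_comm] using (hp i).pow 2
      have hmul : ∀ i j, (p i * p j).IsHomogeneous (2 * d) := fun i j => by
        simpa [two_mul] using (hp i).mul (hp j)
      exact ((((((hsq 1).add ((hmul 0 1).C_mul _)).add ((hmul 1 2).C_mul _)).sub
        ((hsq 0).C_mul _)).sub ((hmul 0 2).C_mul _)).sub ((hsq 2).C_mul _)).sub ((hsq 0).C_mul _)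
    · rw [hfP] at hcP
      simp [hcP, homCoord_zero, hc]
    · by_cases hQ : ∃ i, MvPolynomial.eval (homCoord Q) (p i) ≠ 0
      · obtain ⟨b, hb, hbQ⟩ := hpf Q hQ
        rcases hfQ : f Q with _ | ⟨x', y', hxy'⟩
        · rw [hfQ] at hbQ
          simp [hfQ, hbQ, homCoord_zero, invXSub_zero]
        · rw [hfQ] at hbQ
          have hne := sub_ne_zero.2 (hx₀ Q _ _ _ hfQ)
          have hE := hxy'.1
          rw [WeierstrassCurve.Affine.equation_iff] at hE
          simp only [map_sub, map_add, map_mul, map_pow, MvPolynomial.eval_C, hbQ, hfQ,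
            homCoord_some, Matrix.cons_val, invXSub_some]
          field_simp
          linear_combination hE
      · push Not at hQ
        simp [hQ]
  · refine ⟨d, p 2, p 0 - MvPolynomial.C x₀ * p 2, hp 2, (hp 0).sub ((hp 2).C_mul _), ?_,
      fun Q => ?_⟩
    · rw [hfP] at hcP
      have hne := sub_ne_zero.2 (hx₀ P _ _ _ hfP)
      simp only [map_sub, map_mul, MvPolynomial.eval_C, hcP, homCoord_some, Matrix.cons_val]
      rw [show c * x - x₀ * (c * 1) = c * (x - x₀) by ring]
      exact mul_ne_zero hc hne
    · by_cases hQ : ∃ i, MvPolynomial.eval (homCoord Q) (p i) ≠ 0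
      · obtain ⟨b, hb, hbQ⟩ := hpf Q hQ
        rcases hfQ : f Q with _ | ⟨x', y', hxy'⟩
        · rw [hfQ] at hbQ
          simp [hfQ, hbQ, homCoord_zero, invXSub_zero]
        · rw [hfQ] at hbQ
          have hne := sub_ne_zero.2 (hx₀ Q _ _ _ hfQ)
          simp only [map_sub, map_mul, MvPolynomial.eval_C, hbQ, hfQ, homCoord_some,
            Matrix.cons_val, invXSub_some]
          field_simp
      · push Not at hQ
        simp [hQ]

/-- Nonzero endomorphisms of an elliptic curve over an algebraically closed field are surjective. -/
theorem IsMorphism.surjective [DecidableEq K] [IsAlgClosed K] [W.IsElliptic]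
    {f : AddMonoid.End W.Point} (hf : IsMorphism f) (hf0 : f ≠ 0) : Function.Surjective f := by
  intro Q
  by_contra! hQ
  rcases Q with _ | ⟨x₀, y₀, hxy₀⟩
  · exact hQ 0 (map_zero f)
  have hx₀ : ∀ P x y hxy, f P = .some x y hxy → x ≠ x₀ := by
    rintro P x y hxy hP rfl
    have hproj : proj (f P) = proj (.some x y₀ hxy₀) := by
      simp only [hP, proj, WeierstrassCurve.Affine.Point.xRep]
    rcases proj_eq_iff.1 hproj with h | h
    · exact hQ P h
    · exact hQ (-P) (by rw [map_neg, h, neg_neg])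
  refine hf0 (AddMonoidHom.ext fun P => ?_)
  have hzero := (hf.isRegular_invXSub_comp hx₀).eq_zero (by simp only [map_zero]; rfl) P
  rcases hP : f P with _ | ⟨x, y, hxy⟩
  · exact hP
  · rw [hP] at hzero
    exact absurd hzero (inv_ne_zero (sub_ne_zero.2 (hx₀ P x y hxy hP)))

/-! ### Images of the diagonal under iterates of Lattès maps -/

section Lattes

variable [DecidableEq K] [IsAlgClosed K] [W.IsElliptic]

lemma lattes_iterate_proj (f : AddMonoid.End W.Point) (n : ℕ) (P : W.Point) :
    (lattes f)^[n] (proj P) = proj ((f ^ n) P) := by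
  induction n with
  | zero => rfl
  | succ n ih =>
    rw [Function.iterate_succ_apply', ih, lattes_proj, pow_succ']
    rfl

lemma mem_iterate_image_diagonal (f g : AddMonoid.End W.Point) (n : ℕ)
    (t : (ℙ K (Fin 2 → K)) × (ℙ K (Fin 2 → K))) :
    t ∈ (Prod.map (lattes f) (lattes g))^[n] '' Set.diagonal (ℙ K (Fin 2 → K)) ↔
      ∃ P : W.Point, (proj ((f ^ n) P), proj ((g ^ n) P)) = t := by
  rw [Prod.map_iterate]
  constructor
  · rintro ⟨⟨a, b⟩, hab, rfl⟩
    obtain rfl : a = b := hab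
    obtain ⟨P, rfl⟩ := proj_surjective (W := W) a
    exact ⟨P, by simp only [Prod.map_apply, lattes_iterate_proj]⟩
  · rintro ⟨P, rfl⟩
    exact ⟨(proj P, proj P), rfl, by simp only [Prod.map_apply, lattes_iterate_proj]⟩

end Lattes

/-- A group is not the union of two proper subgroups, here the kernels of `f` and `g`. -/
lemma eq_zero_or_eq_zero_of_forall {G : Type*} [AddGroup G] (f g : G →+ G)
    (h : ∀ x, f x = 0 ∨ g x = 0) : f = 0 ∨ g = 0 := by
  by_contra! hne
  obtain ⟨⟨x, hx⟩, ⟨y, hy⟩⟩ := And.intro (DFunLike.ne_iff.1 hne.1) (DFunLike.ne_iff.1 hne.2)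
  have hx' := (h x).resolve_left hx
  have hy' := (h y).resolve_right hy
  rcases h (x + y) with h | h
  · rw [map_add, hy', add_zero] at h
    exact hx h
  · rw [map_add, hx', zero_add] at h
    exact hy h

/-! ### Preperiodicity of the diagonal -/

section CM

variable [DecidableEq K] [IsAlgClosed K] [W.IsElliptic] {R : Type*} [CommRing R] [IsDomain R]

theorem isPreperiodic_of_pow_eq (cm : ComplexMultiplication W R) {a b : R} (hb : b ≠ 0) {k : ℕ}
    (hk : 0 < k) (h : a ^ k = b ^ k ∨ a ^ k = -b ^ k) :
    IsPreperiodic (Prod.map (lattes (cm.mulBy a)) (lattes (cm.mulBy b)))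
      (Set.diagonal (ℙ K (Fin 2 → K))) := by
  refine ⟨0, k, hk, Set.ext fun t => ?_⟩
  have hproj : ∀ P : W.Point, proj ((cm.mulBy a ^ k) P) = proj ((cm.mulBy b ^ k) P) := by
    intro P
    rw [← map_pow, ← map_pow, proj_eq_iff]
    rcases h with h | h
    · exact Or.inl (by rw [h])
    · exact Or.inr (by rw [h, map_neg]; rfl)
  have hsurj : Function.Surjective (cm.mulBy (b ^ k)) :=
    (cm.isMorphism _).surjective fun h0 =>
      pow_ne_zero k hb (cm.injective (h0.trans (map_zero _).symm))
  rw [zero_add, mem_iterate_image_diagonal, Function.iterate_zero, Set.image_id]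
  constructor
  · rintro ⟨P, rfl⟩
    exact hproj P
  · rcases t with ⟨t, t'⟩
    intro ht
    obtain rfl : t = t' := ht
    obtain ⟨Q, rfl⟩ := proj_surjective (W := W) t
    obtain ⟨P, rfl⟩ := hsurj Q
    exact ⟨P, by rw [hproj, ← map_pow]⟩

theorem exists_pow_eq_of_isPreperiodic (cm : ComplexMultiplication W R) {a b : R} (ha : a ≠ 0)
    (hb : b ≠ 0)
    (h : IsPreperiodic (Prod.map (lattes (cm.mulBy a)) (lattes (cm.mulBy b)))
      (Set.diagonal (ℙ K (Fin 2 → K)))) :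
    ∃ k : ℕ, 0 < k ∧ (a ^ k = b ^ k ∨ a ^ k = -b ^ k) := by
  obtain ⟨n, k, hk, h⟩ := h
  refine ⟨k, hk, ?_⟩
  have mul_apply : ∀ (r s : R) (P : W.Point), cm.mulBy (r * s) P = cm.mulBy r (cm.mulBy s P) :=
    fun r s P => by rw [map_mul]; rfl
  have add_apply : ∀ (r s : R) (P : W.Point),
      cm.mulBy (r + s) P = cm.mulBy r P + cm.mulBy s P := fun r s P => by rw [map_add]; rfl
  have neg_apply : ∀ (r : R) (P : W.Point), cm.mulBy (-r) P = -cm.mulBy r P :=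
    fun r P => by rw [map_neg]; rfl
  have key : ∀ P : W.Point, cm.mulBy (a ^ n * b ^ n * (a ^ k - b ^ k)) P = 0 ∨
      cm.mulBy (a ^ n * b ^ n * (a ^ k + b ^ k)) P = 0 := by
    intro P
    have hP := (mem_iterate_image_diagonal (cm.mulBy a) (cm.mulBy b) (n + k) _).2 ⟨P, rfl⟩
    rw [h, mem_iterate_image_diagonal] at hP
    obtain ⟨Q, hQ⟩ := hP
    simp only [Prod.mk.injEq, ← map_pow, proj_eq_iff] at hQ
    -- Both sides below are, up to sign, `[a ^ n * b ^ n] Q`.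
    have hcomb : cm.mulBy (b ^ n * a ^ (n + k)) P = cm.mulBy (a ^ n * b ^ (n + k)) P ∨
        cm.mulBy (b ^ n * a ^ (n + k)) P = -cm.mulBy (a ^ n * b ^ (n + k)) P := by
      have hcomm : cm.mulBy (b ^ n) (cm.mulBy (a ^ n) Q) =
          cm.mulBy (a ^ n) (cm.mulBy (b ^ n) Q) := by
        rw [← mul_apply, ← mul_apply, mul_comm]
      obtain ⟨h1 | h1, h2 | h2⟩ := hQ <;>
        simp only [h1, h2, map_neg, ← mul_apply] at hcomm
      · exact Or.inl hcomm
      · exact Or.inr hcomm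
      · exact Or.inr (neg_eq_iff_eq_neg.1 hcomm)
      · exact Or.inl (neg_injective hcomm)
    have hsub : a ^ n * b ^ n * (a ^ k - b ^ k) =
        b ^ n * a ^ (n + k) + -(a ^ n * b ^ (n + k)) := by ring
    have hadd : a ^ n * b ^ n * (a ^ k + b ^ k) =
        b ^ n * a ^ (n + k) + a ^ n * b ^ (n + k) := by ring
    rw [hsub, hadd, add_apply, add_apply, neg_apply]
    rcases hcomb with h | h
    · exact Or.inl (by rw [h, add_neg_cancel])
    · exact Or.inr (by rw [h, neg_add_cancel])
  have hab : a ^ n * b ^ n ≠ 0 := mul_ne_zero (pow_ne_zero n ha) (pow_ne_zero n hb)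
  rcases eq_zero_or_eq_zero_of_forall _ _ key with h0 | h0
  · have := cm.injective (h0.trans (map_zero cm.mulBy).symm)
    exact Or.inl (sub_eq_zero.1 ((mul_eq_zero.1 this).resolve_left hab))
  · have := cm.injective (h0.trans (map_zero cm.mulBy).symm)
    exact Or.inr (eq_neg_of_add_eq_zero_left ((mul_eq_zero.1 this).resolve_left hab))

end CM

end CMLattes

theorem lemma2p3 {K : Type*} [Field K] [DecidableEq K] [IsAlgClosed K]
    (W : WeierstrassCurve.Affine K) [W.IsElliptic]
    {F : Type*} [Field F] [NumberField F] [Algebra.IsQuadraticExtension ℚ F]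
    [NumberField.IsTotallyComplex F] (R : Subring F) (hR : CMLattes.IsOrder R)
    (cm : CMLattes.ComplexMultiplication W R)
    (ω ω' : R) (hω : ω ≠ 0) (hω' : ω' ≠ 0) :
    CMLattes.IsPreperiodic
        (Prod.map (CMLattes.lattes (cm.mulBy ω)) (CMLattes.lattes (cm.mulBy ω')))
        (Set.diagonal (ℙ K (Fin 2 → K))) ↔
      ∃ k : ℕ, 0 < k ∧ (((ω : F) / (ω' : F)) ^ k = 1 ∨ ((ω : F) / (ω' : F)) ^ k = -1) := by
  have hpow : ∀ k : ℕ, (((ω : F) / (ω' : F)) ^ k = 1 ∨ ((ω : F) / (ω' : F)) ^ k = -1) ↔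
      (ω ^ k = ω' ^ k ∨ ω ^ k = -ω' ^ k) := by
    intro k
    have hne : (ω' : F) ^ k ≠ 0 := pow_ne_zero k (by simpa using hω')
    rw [div_pow, div_eq_iff hne, div_eq_iff hne, one_mul, neg_one_mul]
    refine or_congr ?_ ?_ <;> rw [Subtype.ext_iff] <;> simp
  constructor
  · intro h
    obtain ⟨k, hk, h⟩ := CMLattes.exists_pow_eq_of_isPreperiodic cm hω hω' h
    exact ⟨k, hk, (hpow k).2 h⟩
  · rintro ⟨k, hk, h⟩
    exact CMLattes.isPreperiodic_of_pow_eq cm hω' hk ((hpow k).1 h)
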